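/- Let $G$ be a group and $f$ an automorphism of $G$ satisfying the identity $$(\ast)\qquad 1_G=f^{m_1}(x^{n_1})\cdot f^{m_2}(x^{n_2})\cdots f^{m_k}(x^{n_k})\quad\text{for all }x\in G,$$ where $m_1,\dots,m_k\in\mathbb{Z}_{\ge 0}$ and $n_1,\dots,n_k\in\mathbb{Z}$ are fixed. For a field $\mathbb{F}$ let $r_{\mathbb{F}}(z)=\sum_{t=1}^k n_t z^{m_t}\in\mathbb{F}[z]$. Let $(N_i)_{i\ge 1}$ be a characteristic $N$-series of $G$, i.e. a descending chain $G=N_1\ge N_2\ge\cdots$ of characteristic subgroups with $[N_i,N_j]\le N_{i+j}$ for all $i,j$, and let $L=\bigoplus_{i\ge 1}N_i/N_{i+1}$ be the corresponding Lie ring, whose bracket is the biadditive extension of $[xN_{i+1},yN_{j+1}]=[x,y]N_{i+j+1}$ ($x\in N_i$, $y\in N_j$). (1) There is a Lie ring endomorphism $\bar f:L\to L$ with $\bar f(xN_{i+1})=f(x)N_{i+1}$ for all $i$ and all $x\in N_i$, and it satisfies $\sum_{t=1}^k n_t\,\bar f^{\,m_t}(v)=0$ for all $v\in L$. (2) If the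 additive group of $L$ is isomorphic to $\mathbb{Z}^h$ for some integer $h\ge 0$, then $L$ embeds, via $v\mapsto 1\otimes v$, into the Lie algebra $\widetilde L=\overline{\mathbb{Q}}\otimes_{\mathbb{Z}}L$ over $\overline{\mathbb{Q}}$, which has dimension $h$ and admits a grading $\widetilde L=\bigoplus_{a\in\overline{\mathbb{Q}}}\widetilde L_a$ by subspaces with $[\widetilde L_a,\widetilde L_b]\subseteq\widetilde L_{ab}$ whose support $X=\{a:\widetilde L_a\ne 0\}$ does not contain $0$ and satisfies $r_{\mathbb{Q}}(a)=0$ for all $a\in X$. (3) If $p$ is a prime and the additive group of $L$ is isomorphic to $(\mathbb{Z}/p\mathbb{Z})^h$ for some integer $h\ge 0$, then the same holds with $\overline{\mathbb{F}}_p$ in place of $\overline{\mathbb{Q}}$ and $r_{\mathbb{F}_p}$ in place of $r_{\mathbb{Q}}$: $L$ embeds via $v\mapsto 1\otimes v$ into the Lie algebra $\widetilde L=\overline{\mathbb{F}}_p\otimes_{\mathbb{Z}}L$ over $\overline{\mathbb{F}}_p$, which has dimension $h$ and admits a grading by $(\overline{\mathbb{F}}_p,\cdot)$ whose support does not contain $0$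 and consists of roots of $r_{\mathbb{F}_p}$. -/

import Mathlib

open scoped TensorProduct DirectSum commutatorElement

/-- An `N`-series of `G`: a descending chain `G = N₁ ≥ N₂ ≥ N₃ ≥ ⋯` of subgroups such that
`[N_i, N_j] ≤ N_{i+j}` for all `i, j ≥ 1`. -/
structure NSeries (G : Type*) [Group G] where
  term : ℕ+ → Subgroup G
  term_one : term 1 = ⊤
  antitone : Antitone term
  commutator_le : ∀ i j, ⁅term i, term j⁆ ≤ term (i + j)

namespace NSeries

variable {G : Type*} [Group G] (N : NSeries G)

theorem comm_mem {i j : ℕ+} {x y : G} (hx : x ∈ N.term i) (hy : y ∈ N.term j) :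
    ⁅x, y⁆ ∈ N.term (i + j) :=
  N.commutator_le i j (Subgroup.commutator_mem_commutator hx hy)

theorem mem_of_le {i j : ℕ+} (h : i ≤ j) {x : G} (hx : x ∈ N.term j) : x ∈ N.term i :=
  N.antitone h hx

theorem succ_le_add (i j : ℕ+) : j + 1 ≤ i + j := by
  rw [add_comm i j]; exact add_le_add_right (show (1 : ℕ+) ≤ i from one_le) j

theorem term_normal (i : ℕ+) : (N.term i).Normal := by
  refine ⟨fun x hx g => ?_⟩
  have h : ⁅g, x⁆ ∈ N.term (1 + i) :=
    N.comm_mem (by rw [N.term_one]; exact Subgroup.mem_top g) hx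
  have h' := (N.term i).mul_mem (N.mem_of_le (by rw [add_comm]; exact (PNat.lt_add_right i 1).le) h) hx
  simpa [commutatorElement_def] using h'

instance factor_normal (i : ℕ+) : ((N.term (i + 1)).subgroupOf (N.term i)).Normal :=
  @Subgroup.normal_subgroupOf _ _ _ _ (N.term_normal (i + 1))

/-- The section `N_i / N_{i+1}`. -/
abbrev Factor (i : ℕ+) : Type _ := N.term i ⧸ (N.term (i + 1)).subgroupOf (N.term i)

theorem factor_eq_iff {i : ℕ+} {x y : N.term i} :
    (QuotientGroup.mk x : N.Factor i) = QuotientGroup.mk y ↔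
      (x : G)⁻¹ * (y : G) ∈ N.term (i + 1) := by
  rw [QuotientGroup.eq, Subgroup.mem_subgroupOf]; simp

/-- The sections of an `N`-series are abelian. -/
instance factorCommGroup (i : ℕ+) : CommGroup (N.Factor i) where
  mul_comm a b := by
    induction a using QuotientGroup.induction_on with | _ x =>
    induction b using QuotientGroup.induction_on with | _ y =>
    rw [← QuotientGroup.mk_mul, ← QuotientGroup.mk_mul, factor_eq_iff]
    have h := N.mem_of_le (succ_le_add i i)
      (N.comm_mem ((N.term i).inv_mem y.2) ((N.term i).inv_mem x.2))
    simpa [commutatorElement_def, mul_assoc] using h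

/-- The underlying additive group `⨁_{i ≥ 1} N_i / N_{i+1}` of the Lie ring of an `N`-series. -/
def LieRingOf : Type _ := ⨁ i : ℕ+, Additive (N.Factor i)

noncomputable instance : AddCommGroup N.LieRingOf :=
  inferInstanceAs (AddCommGroup (⨁ i : ℕ+, Additive (N.Factor i)))

/-- The inclusion of the section `N_i / N_{i+1}` as homogeneous component of degree `i`. -/
noncomputable def component (i : ℕ+) : Additive (N.Factor i) →+ N.LieRingOf :=
  DirectSum.of (fun i : ℕ+ => Additive (N.Factor i)) i

/-- The homogeneous element of degree `i` given by the class `x N_{i+1}` of `x ∈ N_i`. -/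
noncomputable def cls (i : ℕ+) (x : N.term i) : N.LieRingOf :=
  N.component i (Additive.ofMul (QuotientGroup.mk x))

theorem cls_mul (i : ℕ+) (x y : N.term i) : N.cls i (x * y) = N.cls i x + N.cls i y := by
  simp only [cls, QuotientGroup.mk_mul, ofMul_mul, map_add]

theorem cls_one (i : ℕ+) : N.cls i 1 = 0 := by
  simp only [cls, QuotientGroup.mk_one, ofMul_one, map_zero]

theorem cls_congr {i : ℕ+} {x y : N.term i} (h : (x : G)⁻¹ * (y : G) ∈ N.term (i + 1)) :
    N.cls i x = N.cls i y := by
  rw [cls, cls, N.factor_eq_iff.2 h]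

theorem cls_cast {i j : ℕ+} (h : i = j) {x : N.term i} {y : N.term j} (hxy : (x : G) = y) :
    N.cls i x = N.cls j y := by
  subst h; rw [Subtype.ext hxy]

/-- Every element of the Lie ring is a finite sum of homogeneous classes. -/
theorem induction_cls {p : N.LieRingOf → Prop} (v : N.LieRingOf) (h0 : p 0)
    (hc : ∀ i x, p (N.cls i x)) (ha : ∀ v w, p v → p w → p (v + w)) : p v := by
  refine DirectSum.induction_on (motive := p) v h0 (fun i a => ?_) ha
  obtain ⟨x, hx⟩ := QuotientGroup.mk_surjective (Additive.toMul a)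
  have := hc i x
  rw [cls, hx] at this
  exact this

/-- The commutator map `N_i × N_j → N_{i+j}`. -/
def comm (i j : ℕ+) (x : N.term i) (y : N.term j) : N.term (i + j) :=
  ⟨⁅(x : G), (y : G)⁆, N.comm_mem x.2 y.2⟩

/-- Modulo `N_{i+1}`, elements of `N_i` are unchanged by conjugation. -/
theorem conj_mem {i : ℕ+} (g : G) {z : G} (hz : z ∈ N.term i) :
    z⁻¹ * (g * z * g⁻¹) ∈ N.term (i + 1) := by
  have h := N.comm_mem ((N.term i).inv_mem hz)
    (show g ∈ N.term 1 by rw [N.term_one]; exact Subgroup.mem_top g)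
  simpa [commutatorElement_def, mul_assoc] using h

theorem cls_comm_mul_right (i j : ℕ+) (x : N.term i) (y y' : N.term j) :
    N.cls (i + j) (N.comm i j x (y * y')) =
      N.cls (i + j) (N.comm i j x y) + N.cls (i + j) (N.comm i j x y') := by
  have hn := N.term_normal (i + j)
  have e : N.comm i j x (y * y') =
      N.comm i j x y * ⟨y * N.comm i j x y' * (y : G)⁻¹, hn.conj_mem _ (N.comm i j x y').2 _⟩ := by
    apply Subtype.ext
    simp [comm, commutatorElement_def, mul_assoc]
  rw [e, cls_mul]
  congr 1
  exact (N.cls_congr (N.conj_mem _ (N.comm i j x y').2)).symm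

theorem cls_comm_mul_left (i j : ℕ+) (x x' : N.term i) (y : N.term j) :
    N.cls (i + j) (N.comm i j (x * x') y) =
      N.cls (i + j) (N.comm i j x y) + N.cls (i + j) (N.comm i j x' y) := by
  have hn := N.term_normal (i + j)
  have e : N.comm i j (x * x') y =
      ⟨x * N.comm i j x' y * (x : G)⁻¹, hn.conj_mem _ (N.comm i j x' y).2 _⟩ * N.comm i j x y := by
    apply Subtype.ext
    simp [comm, commutatorElement_def, mul_assoc]
  rw [e, cls_mul, add_comm]
  congr 1
  exact (N.cls_congr (N.conj_mem _ (N.comm i j x' y).2)).symm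

theorem cls_eq_zero {i : ℕ+} {x : N.term i} (h : (x : G) ∈ N.term (i + 1)) : N.cls i x = 0 := by
  rw [← N.cls_one i]
  exact N.cls_congr (by simpa using h)

/-- The commutator map in its second variable, on the section `N_j / N_{j+1}`. -/
noncomputable def bracketRight (i j : ℕ+) (x : N.term i) :
    Additive (N.Factor j) →+ N.LieRingOf :=
  MonoidHom.toAdditiveLeft (QuotientGroup.lift ((N.term (j + 1)).subgroupOf (N.term j))
    (MonoidHom.mk' (fun y : N.term j => Multiplicative.ofAdd (N.cls (i + j) (N.comm i j x y)))
      (fun y y' => by rw [cls_comm_mul_right, ofAdd_add]))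
    (fun y hy => by
      have h : (N.comm i j x y : G) ∈ N.term (i + j + 1) := by
        rw [add_assoc]; exact N.comm_mem x.2 hy
      simp [N.cls_eq_zero h]))

theorem bracketRight_mk (i j : ℕ+) (x : N.term i) (y : N.term j) :
    N.bracketRight i j x (Additive.ofMul (QuotientGroup.mk y)) =
      N.cls (i + j) (N.comm i j x y) := rfl

theorem hom_ext {j : ℕ+} {φ ψ : Additive (N.Factor j) →+ N.LieRingOf}
    (h : ∀ y : N.term j, φ (Additive.ofMul (QuotientGroup.mk y)) =
      ψ (Additive.ofMul (QuotientGroup.mk y))) : φ = ψ := by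
  refine AddMonoidHom.ext fun a => ?_
  obtain ⟨y, hy⟩ := QuotientGroup.mk_surjective (Additive.toMul a)
  have := h y
  rw [hy] at this
  exact this

/-- The biadditive map `N_i / N_{i+1} × N_j / N_{j+1} → N_{i+j} / N_{i+j+1}` given by commutators,
with values in the direct sum. -/
noncomputable def bracketComponent (i j : ℕ+) :
    Additive (N.Factor i) →+ Additive (N.Factor j) →+ N.LieRingOf :=
  MonoidHom.toAdditiveLeft (QuotientGroup.lift ((N.term (i + 1)).subgroupOf (N.term i))
    (MonoidHom.mk' (fun x : N.term i => Multiplicative.ofAdd (N.bracketRight i j x))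
      (fun x x' => by
        rw [← ofAdd_add]
        congr 1
        refine N.hom_ext fun y => ?_
        rw [AddMonoidHom.add_apply, bracketRight_mk, bracketRight_mk, bracketRight_mk,
          cls_comm_mul_left]))
    (fun x hx => by
      change Multiplicative.ofAdd (N.bracketRight i j x) = Multiplicative.ofAdd 0
      congr 1
      refine N.hom_ext fun y => ?_
      have h : (N.comm i j x y : G) ∈ N.term (i + j + 1) := by
        rw [add_right_comm]; exact N.comm_mem hx y.2
      rw [bracketRight_mk, N.cls_eq_zero h, AddMonoidHom.zero_apply]))

/-- The biadditive extension of the commutator maps to the direct sum. -/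
noncomputable def bracketSum : (⨁ i : ℕ+, Additive (N.Factor i)) →+
    (⨁ i : ℕ+, Additive (N.Factor i)) →+ N.LieRingOf :=
  DirectSum.toAddMonoid fun i => AddMonoidHom.flip
    (DirectSum.toAddMonoid fun j => (N.bracketComponent i j).flip)

/-- The same map, on the Lie ring. -/
noncomputable def bracketHom : N.LieRingOf →+ N.LieRingOf →+ N.LieRingOf := N.bracketSum

noncomputable instance : Bracket N.LieRingOf N.LieRingOf := ⟨fun v w => N.bracketHom v w⟩

/-- On homogeneous elements, the bracket is the class of the group commutator. -/
theorem lie_cls (i j : ℕ+) (x : N.term i) (y : N.term j) :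
    ⁅N.cls i x, N.cls j y⁆ = N.cls (i + j) (N.comm i j x y) := by
  change N.bracketSum
    (DirectSum.of (fun i : ℕ+ => Additive (N.Factor i)) i (Additive.ofMul (QuotientGroup.mk x)))
    (DirectSum.of (fun i : ℕ+ => Additive (N.Factor i)) j (Additive.ofMul (QuotientGroup.mk y))) = _
  rw [bracketSum, DirectSum.toAddMonoid_of, AddMonoidHom.flip_apply, DirectSum.toAddMonoid_of]
  rfl

theorem add_lie' (u v w : N.LieRingOf) : ⁅u + v, w⁆ = ⁅u, w⁆ + ⁅v, w⁆ := by
  change N.bracketHom (u + v) w = _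
  rw [map_add]; rfl

theorem lie_add' (u v w : N.LieRingOf) : ⁅u, v + w⁆ = ⁅u, v⁆ + ⁅u, w⁆ :=
  map_add (N.bracketHom u) v w

theorem zero_lie' (w : N.LieRingOf) : ⁅(0 : N.LieRingOf), w⁆ = 0 := by
  change N.bracketHom 0 w = _
  rw [map_zero]; rfl

theorem lie_zero' (w : N.LieRingOf) : ⁅w, (0 : N.LieRingOf)⁆ = 0 :=
  map_zero (N.bracketHom w)

theorem lie_skew' (v w : N.LieRingOf) : ⁅v, w⁆ + ⁅w, v⁆ = 0 := by
  induction v using N.induction_cls with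
  | h0 => rw [zero_lie', lie_zero', add_zero]
  | ha a b ha hb =>
    rw [add_lie', lie_add', add_add_add_comm, ha, hb, add_zero]
  | hc i x =>
    induction w using N.induction_cls with
    | h0 => rw [zero_lie', lie_zero', add_zero]
    | ha a b ha hb =>
      rw [add_lie', lie_add', add_add_add_comm, ha, hb, add_zero]
    | hc j y =>
      rw [lie_cls, lie_cls, N.cls_cast (add_comm j i) (x := N.comm j i y x)
        (y := (N.comm i j x y)⁻¹) (by simp [comm, commutatorElement_inv]), ← cls_mul,
        mul_inv_cancel, cls_one]

theorem lie_self' (v : N.LieRingOf) : ⁅v, v⁆ = 0 := by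
  induction v using N.induction_cls with
  | h0 => rw [zero_lie']
  | ha a b ha hb =>
    rw [add_lie', lie_add', lie_add', ha, hb, zero_add, add_zero, lie_skew']
  | hc i x =>
    rw [lie_cls, ← N.cls_one (i + i)]
    congr 1
    exact Subtype.ext (by simp [comm])

theorem jacobi_cls (i j k : ℕ+) (x : N.term i) (y : N.term j) (z : N.term k) :
    ⁅⁅N.cls i x, N.cls j y⁆, N.cls k z⁆ + ⁅⁅N.cls j y, N.cls k z⁆, N.cls i x⁆
      + ⁅⁅N.cls k z, N.cls i x⁆, N.cls j y⁆ = 0 := by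
  have conj (l : ℕ+) (g : G) (u : N.term l) :
      N.cls l u = N.cls l ⟨g * u * g⁻¹, (N.term_normal l).conj_mem _ u.2 _⟩ :=
    N.cls_congr (N.conj_mem g u.2)
  have e1 : j + k + i = i + j + k := by rw [add_comm, add_assoc]
  have e2 : k + i + j = i + j + k := by rw [add_assoc, add_comm]
  have h1 := N.lie_cls (i + j) k (N.comm i j x y)
    ⟨y * z * (y : G)⁻¹, (N.term_normal k).conj_mem _ z.2 _⟩
  have h2 := N.lie_cls (j + k) i (N.comm j k y z)
    ⟨z * x * (z : G)⁻¹, (N.term_normal i).conj_mem _ x.2 _⟩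
  have h3 := N.lie_cls (k + i) j (N.comm k i z x)
    ⟨x * y * (x : G)⁻¹, (N.term_normal j).conj_mem _ y.2 _⟩
  rw [← conj, ← lie_cls] at h1 h2 h3
  rw [h1, h2, h3,
    N.cls_cast e1 (y := ⟨_, e1 ▸ (N.comm (j + k) i _ _).2⟩) rfl,
    N.cls_cast e2 (y := ⟨_, e2 ▸ (N.comm (k + i) j _ _).2⟩) rfl, ← cls_mul, ← cls_mul,
    ← N.cls_one (i + j + k)]
  congr 1
  apply Subtype.ext
  simpa [comm] using commutatorElement_commutatorElement_conj_mul (x : G) (y : G) (z : G)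

theorem jacobi' (u v w : N.LieRingOf) : ⁅⁅u, v⁆, w⁆ + ⁅⁅v, w⁆, u⁆ + ⁅⁅w, u⁆, v⁆ = 0 := by
  induction u using N.induction_cls with
  | h0 => simp only [zero_lie', lie_zero', add_zero]
  | ha a b ha hb =>
    simp only [add_lie', lie_add']
    have := congrArg₂ (· + ·) ha hb
    simp only [add_zero] at this
    rw [← this]; abel
  | hc i x =>
    induction v using N.induction_cls with
    | h0 => simp only [zero_lie', lie_zero', add_zero]
    | ha a b ha hb =>
      simp only [add_lie', lie_add']
      have := congrArg₂ (· + ·) ha hb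
      simp only [add_zero] at this
      rw [← this]; abel
    | hc j y =>
      induction w using N.induction_cls with
      | h0 => simp only [zero_lie', lie_zero', add_zero]
      | ha a b ha hb =>
        simp only [add_lie', lie_add']
        have := congrArg₂ (· + ·) ha hb
        simp only [add_zero] at this
        rw [← this]; abel
      | hc k z => exact N.jacobi_cls i j k x y z

/-- The Lie ring `⨁_{i ≥ 1} N_i / N_{i+1}` of an `N`-series, with
`[x N_{i+1}, y N_{j+1}] = [x, y] N_{i+j+1}` for `x ∈ N_i`, `y ∈ N_j`. -/
noncomputable instance : LieRing N.LieRingOf where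
  add_lie := N.add_lie'
  lie_add := N.lie_add'
  lie_self := N.lie_self'
  leibniz_lie u v w := by
    have hneg (a b : N.LieRingOf) : ⁅-a, b⁆ = -⁅a, b⁆ := by
      refine eq_neg_of_add_eq_zero_left ?_
      rw [← add_lie', neg_add_cancel, zero_lie']
    have h := N.jacobi' u v w
    rw [eq_neg_of_add_eq_zero_left (N.lie_skew' ⁅v, w⁆ u),
      eq_neg_of_add_eq_zero_left (N.lie_skew' w u), hneg,
      eq_neg_of_add_eq_zero_left (N.lie_skew' ⁅u, w⁆ v)] at h
    rw [← sub_eq_zero, ← neg_eq_zero, ← h]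
    abel

/-- The series is characteristic if each of its terms is a characteristic subgroup of `G`. -/
def IsCharacteristic : Prop := ∀ i, (N.term i).Characteristic

variable {N} in
theorem IsCharacteristic.apply_mem (hN : N.IsCharacteristic) (f : MulAut G) {i : ℕ+} {x : G}
    (hx : x ∈ N.term i) : f x ∈ N.term i := by
  have h := (hN i).fixed f
  rw [← h] at hx
  exact hx

/-- The map induced on the term `N_i` of a characteristic series by an automorphism of `G`. -/
def restrict (hN : N.IsCharacteristic) (f : MulAut G) (i : ℕ+) (x : N.term i) : N.term i :=
  ⟨f x, hN.apply_mem f x.2⟩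

end NSeries

/-- The automorphism `f` satisfies the identity `1 = f^{m₁}(x^{n₁}) ⋯ f^{m_k}(x^{n_k})`
(product in this order) for all `x`. -/
def SatisfiesIdentity {G : Type*} [Group G] (f : MulAut G) {k : ℕ} (m : Fin k → ℕ)
    (n : Fin k → ℤ) : Prop :=
  ∀ x : G, 1 = (List.ofFn fun t : Fin k => (f ^ m t) (x ^ n t)).prod

/-- The polynomial `r_F(z) = ∑ n_t z^{m_t}` over `F`. -/
noncomputable def identityPolynomial (F : Type*) [Field F] {k : ℕ} (m : Fin k → ℕ)
    (n : Fin k → ℤ) : Polynomial F :=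
  ∑ t, Polynomial.C (n t : F) * Polynomial.X ^ m t

open Classical in
/-- The family `A` of subspaces is a grading of the Lie algebra `L` by the multiplicative monoid
`(K, ·)`: `L` is the direct sum of the `A a`, and `[A a, A b] ⊆ A (a * b)`. -/
def IsMulGrading (K : Type*) {L : Type*} [Field K] [LieRing L] [LieAlgebra K L]
    (A : K → Submodule K L) : Prop :=
  Nonempty (GradedLieAlgebra fun a : Additive K => A a.toMul)

/-- The support of a family of subspaces. -/
def gradingSupport {K L : Type*} [Field K] [LieRing L] [LieAlgebra K L]
    (A : K → Submodule K L) : Set K :=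
  {a | A a ≠ ⊥}

/-- The natural homomorphism of Lie rings from `L` to its extension of scalars `K ⊗ L` over `ℤ`,
which sends `v` to `1 ⊗ v`. -/
noncomputable def toScalarExtension (K L : Type*) [Field K] [LieRing L] : L →ₗ⁅ℤ⁆ K ⊗[ℤ] L where
  toFun v := 1 ⊗ₜ[ℤ] v
  map_add' v w := TensorProduct.tmul_add 1 v w
  map_smul' c v := by simp
  map_lie' := by simp

/-! An automorphism preserves commutators and every term of a characteristic series, so it acts on
each section and, by biadditivity of the bracket, on the Lie ring. Passing to classes turns products
into sums, so the identity of `f` becomes the linear relation `∑ n_t fbar ^ m_t = 0`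
(`sum_zsmul_inducedLieHom_iterate`). After extension of scalars to an algebraically closed field
`K`, `fbar` becomes an endomorphism `T` of a finite-dimensional Lie algebra. The space is the direct
sum of the generalized eigenspaces of `T`, and these multiply under the bracket
(`lie_mem_maxGenEigenspace_mul`), which gives the grading. Its support consists of eigenvalues of
`T`: none is `0` since `T` is injective, and the linear relation, applied to an eigenvector, makes
each a root of the polynomial. Both characteristics are covered by `scalarExtension_grading`. -/

/-! ### The endomorphism of the Lie ring induced by an automorphism -/

namespace NSeries

variable {G : Type*} [Group G] (N : NSeries G)

/-- The class map from the term `N_i` to the Lie ring, as a homomorphism. -/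
noncomputable def clsHom (i : ℕ+) : Additive (N.term i) →+ N.LieRingOf where
  toFun x := N.cls i x.toMul
  map_zero' := N.cls_one i
  map_add' x y := N.cls_mul i x.toMul y.toMul

theorem cls_zpow (i : ℕ+) (x : N.term i) (n : ℤ) : N.cls i (x ^ n) = n • N.cls i x :=
  map_zsmul (N.clsHom i) n (Additive.ofMul x)

theorem cls_list_prod (i : ℕ+) (l : List (N.term i)) :
    N.cls i l.prod = (l.map (N.cls i)).sum := by
  induction l with
  | nil => exact N.cls_one i
  | cons a l ih => rw [List.prod_cons, cls_mul, ih, List.map_cons, List.sum_cons]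

variable {N}

/-- The map on the section `N_i / N_{i+1}` of a characteristic series induced by an
automorphism. -/
def factorMap (hN : N.IsCharacteristic) (f : MulAut G) (i : ℕ+) :
    N.Factor i →* N.Factor i :=
  QuotientGroup.map _ _
    (MonoidHom.mk' (N.restrict hN f i) fun x y => Subtype.ext (map_mul f (x : G) y))
    (fun _ hx => hN.apply_mem f hx)

/-- The additive endomorphism of the Lie ring induced by an automorphism. -/
noncomputable def inducedAddHom (hN : N.IsCharacteristic) (f : MulAut G) :
    N.LieRingOf →+ N.LieRingOf :=
  DirectSum.map fun i => (factorMap hN f i).toAdditive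

theorem inducedAddHom_cls (hN : N.IsCharacteristic) (f : MulAut G) (i : ℕ+) (x : N.term i) :
    inducedAddHom hN f (N.cls i x) = N.cls i (N.restrict hN f i x) :=
  DirectSum.map_of (fun i => (factorMap hN f i).toAdditive) i _

/-- Both sides are biadditive, so homogeneous classes suffice; there it says that `f` preserves
group commutators. -/
theorem inducedAddHom_lie (hN : N.IsCharacteristic) (f : MulAut G) (v w : N.LieRingOf) :
    inducedAddHom hN f ⁅v, w⁆ = ⁅inducedAddHom hN f v, inducedAddHom hN f w⁆ := by
  induction v using N.induction_cls with
  | h0 => simp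
  | ha a b ha hb => simp only [add_lie, map_add, ha, hb]
  | hc i x =>
    induction w using N.induction_cls with
    | h0 => simp
    | ha a b ha hb => simp only [lie_add, map_add, ha, hb]
    | hc j y =>
      simp only [inducedAddHom_cls, lie_cls]
      congr 1
      exact Subtype.ext (map_commutatorElement f (x : G) (y : G))

/-- The endomorphism of the Lie ring of a characteristic series induced by an automorphism. -/
noncomputable def inducedLieHom (hN : N.IsCharacteristic) (f : MulAut G) :
    N.LieRingOf →ₗ⁅ℤ⁆ N.LieRingOf :=
  { (inducedAddHom hN f).toIntLinearMap with
    map_lie' := fun {v w} => inducedAddHom_lie hN f v w }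

theorem inducedLieHom_cls (hN : N.IsCharacteristic) (f : MulAut G) (i : ℕ+) (x : N.term i) :
    inducedLieHom hN f (N.cls i x) = N.cls i (N.restrict hN f i x) :=
  inducedAddHom_cls hN f i x

/-- This left inverse keeps `0` out of the support after extension of scalars. -/
theorem inducedLieHom_inv_apply (hN : N.IsCharacteristic) (f : MulAut G) (v : N.LieRingOf) :
    inducedLieHom hN f⁻¹ (inducedLieHom hN f v) = v := by
  induction v using N.induction_cls with
  | h0 => simp
  | ha a b ha hb => simp only [map_add, ha, hb]
  | hc i x =>
    simp only [inducedLieHom_cls]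
    congr 1
    exact Subtype.ext (MulAut.inv_apply_self G f x)

theorem inducedLieHom_iterate_cls (hN : N.IsCharacteristic) (f : MulAut G) (j : ℕ) (i : ℕ+)
    (x : N.term i) :
    (inducedLieHom hN f)^[j] (N.cls i x) = N.cls i (N.restrict hN (f ^ j) i x) := by
  induction j with
  | zero => rfl
  | succ j ih =>
    rw [Function.iterate_succ_apply', ih, inducedLieHom_cls]
    congr 1
    exact Subtype.ext (by simp [restrict, pow_succ'])

theorem sum_zsmul_inducedLieHom_iterate (hN : N.IsCharacteristic) (f : MulAut G) {k : ℕ}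
    {m : Fin k → ℕ} {n : Fin k → ℤ} (hf : SatisfiesIdentity f m n) (v : N.LieRingOf) :
    ∑ t, n t • (inducedLieHom hN f)^[m t] v = 0 := by
  induction v using N.induction_cls with
  | h0 => simp [iterate_map_zero]
  | ha a b ha hb =>
    simp only [iterate_map_add, smul_add, Finset.sum_add_distrib, ha, hb, add_zero]
  | hc i x =>
    -- The identity at `x` is read inside `N_i`, where taking classes is a homomorphism to an
    -- additive group.
    have h : (List.ofFn fun t => N.restrict hN (f ^ m t) i (x ^ n t)).prod = 1 := by
      apply Subtype.ext
      rw [SubmonoidClass.coe_list_prod, List.map_ofFn]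
      exact (hf x).symm
    have h' := congrArg (N.cls i) h
    rw [cls_list_prod, cls_one, List.map_ofFn, List.sum_ofFn] at h'
    rw [← h']
    refine Finset.sum_congr rfl fun t _ => ?_
    rw [inducedLieHom_iterate_cls, ← cls_zpow]
    simp only [Function.comp]
    congr 1
    exact Subtype.ext (by simp [restrict])

end NSeries

/-! ### Generalized eigenspaces of a Lie algebra endomorphism -/

section Eigenspaces

variable {K V : Type*} [Field K] [LieRing V] [LieAlgebra K V]

open Module

theorem Module.End.mem_maxGenEigenspace_of_sub_smul_mem {T : End K V} {c : K} {v : V}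
    (h : T v - c • v ∈ T.maxGenEigenspace c) : v ∈ T.maxGenEigenspace c := by
  rw [End.mem_maxGenEigenspace] at h ⊢
  obtain ⟨j, hj⟩ := h
  exact ⟨j + 1, by simpa [pow_succ] using hj⟩

/-- The generalized eigenspaces of an endomorphism of a Lie algebra multiply under the bracket. -/
theorem lie_mem_maxGenEigenspace_mul {T : End K V} (hT : ∀ x y, T ⁅x, y⁆ = ⁅T x, T y⁆) {a b : K}
    {x y : V} (hx : x ∈ T.maxGenEigenspace a) (hy : y ∈ T.maxGenEigenspace b) :
    ⁅x, y⁆ ∈ T.maxGenEigenspace (a * b) := by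
  rw [End.mem_maxGenEigenspace] at hx hy
  obtain ⟨i, hi⟩ := hx
  obtain ⟨j, hj⟩ := hy
  -- Double induction on the exponents for which `(T - a) ^ i` kills `x` and `(T - b) ^ j` kills
  -- `y`.
  induction i generalizing x y j with
  | zero => simp [show x = 0 by simpa using hi]
  | succ i ihi =>
    induction j generalizing y with
    | zero => simp [show y = 0 by simpa using hj]
    | succ j ihj =>
      apply End.mem_maxGenEigenspace_of_sub_smul_mem
      -- In the first bracket the exponent of the left entry drops while `T y` keeps that of `y`, as
      -- `T` commutes with `T - b`; in the second the exponent of the right entry drops.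
      have e : T ⁅x, y⁆ - (a * b) • ⁅x, y⁆ =
          ⁅(T - a • (1 : End K V)) x, T y⁆ + a • ⁅x, (T - b • (1 : End K V)) y⁆ := by
        simp [hT, sub_lie, lie_sub, smul_sub, mul_smul]
      rw [e]
      refine add_mem (ihi (j := j + 1) ?_ ?_) (Submodule.smul_mem _ _ (ihj ?_))
      · rwa [pow_succ] at hi
      · have hc : Commute ((T - b • (1 : End K V)) ^ (j + 1)) T :=
          Commute.pow_left ((Commute.refl T).sub_left ((Commute.one_left T).smul_left b)) _
        rw [← Module.End.mul_apply, hc.eq, Module.End.mul_apply, hj, map_zero]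
      · rwa [pow_succ] at hj

/-- `T` need not be diagonalizable, but over an algebraically closed field its generalized
eigenspaces always span. -/
theorem isMulGrading_maxGenEigenspace [IsAlgClosed K] [FiniteDimensional K V] {T : End K V}
    (hT : ∀ x y, T ⁅x, y⁆ = ⁅T x, T y⁆) : IsMulGrading K T.maxGenEigenspace := by
  classical
  have hi : DirectSum.IsInternal fun a : Additive K => T.maxGenEigenspace a.toMul :=
    DirectSum.isInternal_submodule_of_iSupIndep_of_iSup_eq_top
      T.independent_maxGenEigenspace (End.iSup_maxGenEigenspace_eq_top T)
  exact ⟨{ hi.chooseDecomposition with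
    bracket_mem := fun _ _ _ _ hx hy => lie_mem_maxGenEigenspace_mul hT hx hy }⟩

/-- If `T - a` were injective, so would be all its powers, and the generalized eigenspace would
vanish. -/
theorem exists_eigenvector_of_mem_gradingSupport {T : End K V} {a : K}
    (ha : a ∈ gradingSupport T.maxGenEigenspace) : ∃ v, v ≠ 0 ∧ T v = a • v := by
  have h : T.HasEigenvalue a := by
    intro h
    apply ha
    rw [eq_bot_iff]
    intro v hv
    rw [End.mem_maxGenEigenspace] at hv
    obtain ⟨j, hj⟩ := hv
    have hinj : Function.Injective (T - a • (1 : End K V)) := by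
      rw [← LinearMap.ker_eq_bot, ← End.eigenspace_def]
      exact h
    rw [Module.End.pow_apply] at hj
    exact hinj.iterate j (hj.trans (iterate_map_zero _ _).symm)
  obtain ⟨v, hv⟩ := h.exists_hasEigenvector
  exact ⟨v, hv.2, hv.apply_eq_smul⟩

theorem zero_notMem_gradingSupport {T : End K V} (hT : Function.Injective T) :
    0 ∉ gradingSupport T.maxGenEigenspace := by
  intro h
  obtain ⟨v, hv, e⟩ := exists_eigenvector_of_mem_gradingSupport h
  exact hv (hT (by rw [e, zero_smul, map_zero]))

/-- On an eigenvector for `a`, the relation acts as the scalar `∑ n_t a ^ m_t`, which must therefore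
vanish. -/
theorem aeval_identityPolynomial_eq_zero {F : Type*} [Field F] [Algebra F K] {T : End K V} {k : ℕ}
    {m : Fin k → ℕ} {n : Fin k → ℤ} (hT : ∀ v, ∑ t, n t • (T ^ m t) v = 0) {a : K}
    (ha : a ∈ gradingSupport T.maxGenEigenspace) :
    Polynomial.aeval a (identityPolynomial F m n) = 0 := by
  obtain ⟨v, hv, e⟩ := exists_eigenvector_of_mem_gradingSupport ha
  have hpow (j : ℕ) : (T ^ j) v = a ^ j • v := by
    induction j with
    | zero => simp
    | succ j ih => rw [pow_succ', Module.End.mul_apply, ih, map_smul, e, smul_smul, pow_succ]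
  have h : (∑ t, (n t : K) * a ^ m t) • v = 0 := by
    rw [← hT v, Finset.sum_smul]
    refine Finset.sum_congr rfl fun t _ => ?_
    rw [hpow, mul_smul, Int.cast_smul_eq_zsmul]
  simpa [identityPolynomial] using (smul_eq_zero.1 h).resolve_right hv

end Eigenspaces

/-! ### Extension of scalars from the integers -/

section ScalarExtension

variable {R K L : Type*} [CommRing R] [Field K] [Algebra R K] [LieRing L] {h : ℕ}

/-- Every scalar of `R` acts as an integer, so tensor products over `ℤ` and over `R` agree. -/
theorem compatibleSMul_int (hR : Function.Surjective (Int.cast : ℤ → R)) (M N : Type*)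
    [AddCommGroup M] [AddCommGroup N] [Module R M] [Module R N] :
    TensorProduct.CompatibleSMul ℤ R M N where
  smul_tmul r x y := by
    obtain ⟨c, rfl⟩ := hR r
    rw [Int.cast_smul_eq_zsmul, Int.cast_smul_eq_zsmul, TensorProduct.smul_tmul]

/-- If `R` is a quotient of `ℤ` and the additive group of `L` is `R ^ h`, then `K ⊗[ℤ] L` is
`K ^ h` for every `R`-algebra `K`. -/
theorem exists_scalarExtension_equiv (hR : Function.Surjective (Int.cast : ℤ → R))
    (e : L ≃+ (Fin h → R)) :
    ∃ φ : K ⊗[ℤ] L ≃ₗ[K] (Fin h → K), ∀ v j, φ (1 ⊗ₜ v) j = algebraMap R K (e v j) := by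
  have := compatibleSMul_int hR K (Fin h → R)
  -- `K ⊗[ℤ] L ≃ K ⊗[ℤ] R ^ h ≃ K ⊗[R] R ^ h ≃ K ^ h`.
  refine ⟨TensorProduct.AlgebraTensorModule.congr (.refl K K) e.toIntLinearEquiv ≪≫ₗ
    (TensorProduct.equivOfCompatibleSMul ℤ R K K (Fin h → R)).symm ≪≫ₗ
    TensorProduct.piScalarRight R K K (Fin h), fun v j => ?_⟩
  exact (Algebra.algebraMap_eq_smul_one (e v j)).symm

/-- In coordinates, `v ↦ 1 ⊗ v` is the coordinatewise inclusion of `R ^ h` in `K ^ h`. -/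
theorem toScalarExtension_injective (hR : Function.Surjective (Int.cast : ℤ → R))
    (hK : Function.Injective (algebraMap R K)) (e : L ≃+ (Fin h → R)) :
    Function.Injective (toScalarExtension K L) := by
  obtain ⟨φ, hφ⟩ := exists_scalarExtension_equiv (K := K) hR e
  intro v w hvw
  refine e.injective (funext fun j => hK ?_)
  rw [← hφ, ← hφ]
  exact congrArg (fun u => φ u j) hvw

/-- A bijective endomorphism `f` of a Lie ring with `∑ n_t f ^ m_t = 0` grades the scalar
extensions of the Lie ring, with support in the set of nonzero roots of `∑ n_t z ^ m_t`. -/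
theorem scalarExtension_grading {F : Type*} [Field F] [Algebra F K] [IsAlgClosed K]
    (hR : Function.Surjective (Int.cast : ℤ → R)) (hK : Function.Injective (algebraMap R K))
    {k : ℕ} {m : Fin k → ℕ} {n : Fin k → ℤ} {f g : L →ₗ⁅ℤ⁆ L} (hgf : ∀ v, g (f v) = v)
    (hf : ∀ v, ∑ t, n t • f^[m t] v = 0) (e : L ≃+ (Fin h → R)) :
    Function.Injective (toScalarExtension K L) ∧ Module.rank K (K ⊗[ℤ] L) = h ∧
      ∃ A : K → Submodule K (K ⊗[ℤ] L), IsMulGrading K A ∧ 0 ∉ gradingSupport A ∧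
        ∀ a ∈ gradingSupport A, Polynomial.aeval a (identityPolynomial F m n) = 0 := by
  obtain ⟨φ, -⟩ := exists_scalarExtension_equiv (K := K) hR e
  have : FiniteDimensional K (K ⊗[ℤ] L) := φ.symm.finiteDimensional
  let T : Module.End K (K ⊗[ℤ] L) := (f : L →ₗ[ℤ] L).baseChange K
  have hT (c : K) (v : L) : T (c ⊗ₜ v) = c ⊗ₜ f v := rfl
  have hpow (j : ℕ) (c : K) (v : L) : (T ^ j) (c ⊗ₜ v) = c ⊗ₜ f^[j] v := by
    induction j with
    | zero => rfl
    | succ j ih => rw [pow_succ', Module.End.mul_apply, ih, hT, Function.iterate_succ_apply']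
  have hlie (x y : K ⊗[ℤ] L) : T ⁅x, y⁆ = ⁅T x, T y⁆ :=
    (LieAlgebra.ExtendScalars.map (AlgHom.id ℤ K) f).map_lie x y
  have hinj : Function.Injective T := by
    -- A left inverse survives any base change, whereas injectivity alone need not: `K` is not flat
    -- over `ℤ` in characteristic `p`.
    refine Function.LeftInverse.injective (g := (g : L →ₗ[ℤ] L).baseChange K) fun x => ?_
    induction x using TensorProduct.induction_on with
    | zero => simp
    | add a b ha hb => simp only [map_add, ha, hb]
    | tmul c v => exact congrArg (c ⊗ₜ[ℤ] ·) (hgf v)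
  have hsum (x : K ⊗[ℤ] L) : ∑ t, n t • (T ^ m t) x = 0 := by
    induction x using TensorProduct.induction_on with
    | zero => simp
    | add a b ha hb => simp only [map_add, smul_add, Finset.sum_add_distrib, ha, hb, add_zero]
    | tmul c v =>
      simp only [hpow, ← TensorProduct.tmul_smul, ← TensorProduct.tmul_sum, hf,
        TensorProduct.tmul_zero]
  exact ⟨toScalarExtension_injective hR hK e, by simpa using φ.lift_rank_eq, T.maxGenEigenspace,
    isMulGrading_maxGenEigenspace hlie, zero_notMem_gradingSupport hinj,
    fun a ha => aeval_identityPolynomial_eq_zero hsum ha⟩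

end ScalarExtension

theorem mainTheorem8 {G : Type*} [Group G] (f : MulAut G) {k : ℕ} (m : Fin k → ℕ) (n : Fin k → ℤ)
    (hf : SatisfiesIdentity f m n) (N : NSeries G) (hN : N.IsCharacteristic) :
    (∃ fbar : N.LieRingOf →ₗ⁅ℤ⁆ N.LieRingOf,
      (∀ (i : ℕ+) (x : N.term i), fbar (N.cls i x) = N.cls i (N.restrict hN f i x)) ∧
      ∀ v : N.LieRingOf, 0 = ∑ t, n t • fbar^[m t] v) ∧
    (∀ h : ℕ, Nonempty (N.LieRingOf ≃+ (Fin h → ℤ)) →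
      Function.Injective (toScalarExtension (AlgebraicClosure ℚ) N.LieRingOf) ∧
      Module.rank (AlgebraicClosure ℚ) (AlgebraicClosure ℚ ⊗[ℤ] N.LieRingOf) = h ∧
      ∃ A : AlgebraicClosure ℚ →
          Submodule (AlgebraicClosure ℚ) (AlgebraicClosure ℚ ⊗[ℤ] N.LieRingOf),
        IsMulGrading (AlgebraicClosure ℚ) A ∧ 0 ∉ gradingSupport A ∧
        ∀ a ∈ gradingSupport A, Polynomial.aeval a (identityPolynomial ℚ m n) = 0) ∧
    (∀ (p : ℕ) [Fact p.Prime] (h : ℕ), Nonempty (N.LieRingOf ≃+ (Fin h → ZMod p)) →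
      Function.Injective (toScalarExtension (AlgebraicClosure (ZMod p)) N.LieRingOf) ∧
      Module.rank (AlgebraicClosure (ZMod p))
        (AlgebraicClosure (ZMod p) ⊗[ℤ] N.LieRingOf) = h ∧
      ∃ A : AlgebraicClosure (ZMod p) →
          Submodule (AlgebraicClosure (ZMod p)) (AlgebraicClosure (ZMod p) ⊗[ℤ] N.LieRingOf),
        IsMulGrading (AlgebraicClosure (ZMod p)) A ∧ 0 ∉ gradingSupport A ∧
        ∀ a ∈ gradingSupport A, Polynomial.aeval a (identityPolynomial (ZMod p) m n) = 0) := by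
  have hs := NSeries.sum_zsmul_inducedLieHom_iterate hN f hf
  have hi := NSeries.inducedLieHom_inv_apply hN f
  refine ⟨⟨NSeries.inducedLieHom hN f, NSeries.inducedLieHom_cls hN f, fun v => (hs v).symm⟩,
    fun h ⟨e⟩ => ?_, fun p _ h ⟨e⟩ => ?_⟩
  -- Here `R = ℤ` while the coefficient field `F` is `ℚ`; in the second case `R` and `F` are both
  -- `ZMod p`.
  · exact scalarExtension_grading Function.surjective_id (RingHom.injective_int _) hi hs e
  · exact scalarExtension_grading ZMod.intCast_surjective (algebraMap (ZMod p) _).injective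
      hi hs e
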